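/- Fix a rational $\varepsilon\ge 0$. The formulae of continuous Markovian logic (CML) are given by $\phi::=\top\mid\lnot\phi\mid\phi\land\phi\mid L_r\phi$ with $r\in\mathbb Q_{\ge 0}$; put $\bot=\lnot\top$ and $\phi\to\psi=\lnot(\phi\land\lnot\psi)$. A continuous Markov kernel (CMK) is a triple $\mathcal M=(M,\Sigma,\theta)$ where $M$ is an analytic space (homeomorphic to the image of a continuous map between Polish spaces), $\Sigma$ is its Borel $\sigma$-algebra, and $\theta$ is a measurable map from $M$ to the space of finite measures on $(M,\Sigma)$, which carries the $\sigma$-algebra generated by the evaluations $\mu\mapsto\mu(S)$, $S\in\Sigma$. A continuous Markov process (CMP) is a pair $(\mathcal M,m)$ with $m\in M$; it is finite if $M$ is finite. The $\varepsilon$-satisfaction relation is defined by: $m\models_\varepsilon\top$ always; $m\models_\varepsilon\lnot\phi$ iff not $m\models_\varepsilon\phi$; $m\models_\varepsilon\phi\land\psi$ iff $m\models_\varepsilon\phi$ and $m\models_\varepsilon\psi$; and $m\models_\varepsilon L_r\phi$ iff $\theta(m)(\{n\in M: n\models_\varepsilon\phi\})+\varepsilon\ge r$. The derivability relation $\Phi\vdash_\varepsilon\phi$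 between sets of formulae and formulae is the least relation such that $\Phi\vdash_\varepsilon\phi$ for every $\phi\in\Phi$ and for every instance $\phi$ of a propositional tautology, which is closed under modus ponens and under the deduction rule (if $\Phi\cup\{\phi\}\vdash_\varepsilon\psi$ then $\Phi\vdash_\varepsilon\phi\to\psi$), which contains, for all $\Phi$, all formulae $\phi,\psi$ and all $r,s\in\mathbb Q_{\ge0}$ (with $r+s\ge\varepsilon$ in (A3) and (A4)), * (A1) $\Phi\vdash_\varepsilon L_\varepsilon\phi$; * (A2) $\Phi\vdash_\varepsilon L_{r+s}\phi\to L_r\phi$; * (A3) $\Phi\vdash_\varepsilon L_r(\phi\land\psi)\land L_s(\phi\land\lnot\psi)\to L_{r+s-\varepsilon}\phi$; * (A4) $\Phi\vdash_\varepsilon \lnot L_r(\phi\land\psi)\land\lnot L_s(\phi\land\lnot\psi)\to\lnot L_{r+s-\varepsilon}\phi$; and which is closed under the rules * (R1) if $\emptyset\vdash_\varepsilon\phi\to\psi$, then $\Phi\vdash_\varepsilon L_r\phi\to L_r\psi$; * (R2) if $\Phi\vdash_\varepsilon L_r\phi$ for all rationals $r$ with $0\le r<s$, then $\Phi\vdash_\varepsilon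 L_s\phi$; * (R3) if $\Phi\vdash_\varepsilon L_r\phi$ for all rationals $r>s$, then $\Phi\vdash_\varepsilon\bot$. A formula $\phi$ is $\varepsilon$-consistent if $\emptyset\vdash_\varepsilon\phi\to\bot$ does not hold. **Theorem (Finite model property).** For every rational $\varepsilon\ge0$ and every $\varepsilon$-consistent formula $\phi$ there exists a finite CMP $(\mathcal M,m)$ such that $m\models_\varepsilon\phi$. -/

import Mathlib

namespace CML

/-! ## Continuous Markov processes -/

/-- An analytic space: a topological space homeomorphic to the image of a continuous map
between Polish spaces. -/
def IsAnalyticSpace (M : Type*) [TopologicalSpace M] : Prop :=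
  ∃ (P Q : Type) (_ : TopologicalSpace P) (_ : TopologicalSpace Q)
    (_ : PolishSpace P) (_ : PolishSpace Q) (f : P → Q),
    Continuous f ∧ Nonempty (M ≃ₜ Set.range f)

/-- A continuous Markov kernel: an analytic space with its Borel `σ`-algebra and a measurable
map `θ` from the space to the space of finite measures on it. (The `σ`-algebra on measures is
generated by the evaluations at measurable sets, as in `ProbabilityTheory.Kernel`; the total
mass of `θ m` is finite for every `m`, but need not be bounded uniformly in `m`.) -/
structure CMK.{u} where
  /-- the support-set -/
  carrier : Type u
  [topology : TopologicalSpace carrier]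
  [sigma : MeasurableSpace carrier]
  [borel : BorelSpace carrier]
  analytic : IsAnalyticSpace carrier
  /-- the transition function -/
  θ : ProbabilityTheory.Kernel carrier carrier
  finite_rate : ∀ m, MeasureTheory.IsFiniteMeasure (θ m)

attribute [instance] CMK.topology CMK.sigma CMK.borel

/-! ## Syntax -/

/-- Formulae `φ ::= ⊤ | ¬φ | φ ∧ φ | L_r φ`, with `r` a nonnegative rational. -/
inductive Formula : Type
  | top : Formula
  | neg : Formula → Formula
  | and : Formula → Formula → Formula
  | L : ℚ≥0 → Formula → Formula

namespace Formula

/-- `⊥ = ¬⊤`. -/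
def bot : Formula := neg top

/-- `φ → ψ`, that is `¬(φ ∧ ¬ψ)`. -/
def imp (φ ψ : Formula) : Formula := neg (and φ (neg ψ))

/-- Classical propositional truth value, the formulae `L_r φ` being treated as atoms. -/
def eval (v : ℚ≥0 → Formula → Prop) : Formula → Prop
  | top => True
  | neg φ => ¬ eval v φ
  | and φ ψ => eval v φ ∧ eval v ψ
  | L r φ => v r φ

/-- Instances of propositional tautologies. -/
def IsTautology (φ : Formula) : Prop := ∀ v, eval v φ

end Formula

/-! ## Semantics -/

/-- `M.Sat ε φ m` is the `ε`-satisfiability relation `m ⊨_ε φ`; in particular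
`m ⊨_ε L_r φ` iff `θ(m)({n | n ⊨_ε φ}) + ε ≥ r`. -/
def CMK.Sat (M : CMK) (ε : ℚ≥0) : Formula → M.carrier → Prop
  | .top, _ => True
  | .neg φ, m => ¬ M.Sat ε φ m
  | .and φ ψ, m => M.Sat ε φ m ∧ M.Sat ε ψ m
  | .L r φ, m => (r : ℝ) ≤ (M.θ m).real {n | M.Sat ε φ n} + (ε : ℝ)

/-- The sets of states defined by formulae are measurable, so that the clause for `L_r φ` in
`CMK.Sat` makes sense. -/
theorem CMK.measurableSet_sat (M : CMK) (ε : ℚ≥0) (φ : Formula) :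
    MeasurableSet {m | M.Sat ε φ m} := by
  induction φ with
  | top => simp [CMK.Sat]
  | neg φ ih => exact ih.compl
  | and φ ψ ih₁ ih₂ => exact ih₁.inter ih₂
  | L r φ ih =>
    simp only [CMK.Sat]
    exact measurableSet_le measurable_const
      (((M.θ.measurable_coe ih).ennreal_toReal).add measurable_const)

/-! ## Provability -/

open Formula in
/-- `Derives ε Φ φ` is the relation `Φ ⊢_ε φ`: classical propositional logic (tautologies, modus
ponens, discharge of hypotheses) together with the axioms (A1)-(A4) and the rules (R1)-(R3) of
`ε`-provability. All the indices of the operators `L` are nonnegative rationals; in (A3) and (A4)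
the index `t` is `r + s - ε`. (R1) applies to theorems only. (R2) and (R3) are the infinitary
rules `{L_r φ | r < s} ⊢_ε L_s φ` and `{L_r φ | r > s} ⊢_ε ⊥`, closed under cut. -/
inductive Derives (ε : ℚ≥0) : Set Formula → Formula → Prop
  | hyp {Φ : Set Formula} {φ : Formula} : φ ∈ Φ → Derives ε Φ φ
  | taut {Φ : Set Formula} {φ : Formula} : IsTautology φ → Derives ε Φ φ
  | mp {Φ : Set Formula} {φ ψ : Formula} :
      Derives ε Φ (imp φ ψ) → Derives ε Φ φ → Derives ε Φ ψ
  | ded {Φ : Set Formula} {φ ψ : Formula} :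
      Derives ε (insert φ Φ) ψ → Derives ε Φ (imp φ ψ)
  | A1 {Φ : Set Formula} (φ : Formula) : Derives ε Φ (L ε φ)
  | A2 {Φ : Set Formula} (r s : ℚ≥0) (φ : Formula) :
      Derives ε Φ (imp (L (r + s) φ) (L r φ))
  | A3 {Φ : Set Formula} (r s t : ℚ≥0) (φ ψ : Formula) : t + ε = r + s →
      Derives ε Φ (imp (and (L r (and φ ψ)) (L s (and φ (neg ψ)))) (L t φ))
  | A4 {Φ : Set Formula} (r s t : ℚ≥0) (φ ψ : Formula) : t + ε = r + s →
      Derives ε Φ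
        (imp (and (neg (L r (and φ ψ))) (neg (L s (and φ (neg ψ))))) (neg (L t φ)))
  | R1 {Φ : Set Formula} (r : ℚ≥0) {φ ψ : Formula} :
      Derives ε ∅ (imp φ ψ) → Derives ε Φ (imp (L r φ) (L r ψ))
  | R2 {Φ : Set Formula} (s : ℚ≥0) (φ : Formula) :
      (∀ r : ℚ≥0, r < s → Derives ε Φ (L r φ)) → Derives ε Φ (L s φ)
  | R3 {Φ : Set Formula} (s : ℚ≥0) (φ : Formula) :
      (∀ r : ℚ≥0, s < r → Derives ε Φ (L r φ)) → Derives ε Φ bot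

/-- `⊢_ε φ`. -/
def Provable (ε : ℚ≥0) (φ : Formula) : Prop := Derives ε ∅ φ

/-- A formula `φ` is `ε`-consistent if `φ → ⊥` is not `ε`-provable. -/
def Consistent (ε : ℚ≥0) (φ : Formula) : Prop := ¬ Provable ε (Formula.imp φ Formula.bot)

end CML

namespace CML

open Formula MeasureTheory

/-! ## Derivability -/

section Derivability

variable {ε : ℚ≥0} {Φ Ψ : Set Formula} {φ ψ χ γ : Formula}

/-! A Lindenbaum construction extends a consistent formula to a complete set `Γ` that respects (R2)
and (R3) (`Consistent.exists_saturated`). By (R2), `L r φ ∈ Γ` exactly when `r ≤ value Γ φ`. Axioms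
(A1), (A3), (A4) and rule (R1) make `value Γ - ε` a nonnegative, finitely additive function of
formulae that vanishes on inconsistent ones (`value_add`, `value_eq_of_not_consistent`).

Filtration makes the model finite. Its states are the consistent sign patterns ("cells") over the
subformulae of the given formula. Each cell `c` lies in some saturated set, and the rate from `c` to
a cell `d` is the value of `d` in that set, minus `ε`. Summing over the cells that entail `ψ`
recovers the value of `ψ` minus `ε` (`cellMeasure_apply`); the `+ ε` in the semantics of `L` cancels
the shift, and the truth lemma `cellModel_sat_iff` follows. -/

theorem Formula.eval_imp (v : ℚ≥0 → Formula → Prop) (φ ψ : Formula) :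
    eval v (imp φ ψ) ↔ (eval v φ → eval v ψ) := by
  simp [imp, eval]

theorem Derives.weaken (h : Derives ε Φ φ) (hΦ : Φ ⊆ Ψ) : Derives ε Ψ φ := by
  induction h generalizing Ψ with
  | hyp h => exact .hyp (hΦ h)
  | taut h => exact .taut h
  | mp _ _ ih₁ ih₂ => exact .mp (ih₁ hΦ) (ih₂ hΦ)
  | ded _ ih => exact .ded (ih (Set.insert_subset_insert hΦ))
  | A1 φ => exact .A1 φ
  | A2 r s φ => exact .A2 r s φ
  | A3 r s t φ ψ h => exact .A3 r s t φ ψ h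
  | A4 r s t φ ψ h => exact .A4 r s t φ ψ h
  | R1 r h => exact .R1 r h
  | R2 s φ _ ih => exact .R2 s φ fun r hr => ih r hr hΦ
  | R3 s φ _ ih => exact .R3 s φ fun r hr => ih r hr hΦ

theorem Derives.of_provable (h : Provable ε φ) : Derives ε Φ φ :=
  Derives.weaken h (Set.empty_subset _)

/-- Tautological consequence of one derivable formula. -/
theorem Derives.entail (h : Derives ε Φ φ) (hv : ∀ v, eval v φ → eval v ψ) : Derives ε Φ ψ :=
  .mp (.taut fun v => (eval_imp v φ ψ).2 (hv v)) h

/-- Tautological consequence of two derivable formulae. -/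
theorem Derives.entail₂ (h₁ : Derives ε Φ φ) (h₂ : Derives ε Φ ψ)
    (hv : ∀ v, eval v φ → eval v ψ → eval v χ) : Derives ε Φ χ :=
  .mp (.mp (.taut (φ := imp φ (imp ψ χ)) fun v => by
    simpa only [eval_imp] using hv v) h₁) h₂

theorem provable_imp_iff : Provable ε (imp φ ψ) ↔ Derives ε {φ} ψ := by
  constructor
  · intro h
    exact .mp (.of_provable h) (.hyp rfl)
  · intro h
    exact .ded (by simpa using h)

theorem provable_imp_of_entail (hv : ∀ v, eval v φ → eval v ψ) : Provable ε (imp φ ψ) :=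
  .taut fun v => (eval_imp v φ ψ).2 (hv v)

theorem provable_imp_trans (h₁ : Provable ε (imp φ ψ)) (h₂ : Provable ε (imp ψ χ)) :
    Provable ε (imp φ χ) :=
  Derives.entail₂ h₁ h₂ fun v => by simp only [eval_imp]; tauto

theorem Derives.of_inconsistent_and_neg (h : ¬ Consistent ε (and γ (neg φ))) :
    Derives ε {γ} φ := by
  have h : Provable ε (imp (and γ (neg φ)) bot) := not_not.1 h
  refine provable_imp_iff.1 (Derives.entail h fun v => ?_)
  simp only [eval_imp, eval, bot]
  tauto

/-- A consistent formula is consistent with one of `φ`, `¬φ`. -/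
theorem Consistent.and_or (h : Consistent ε γ) (φ : Formula) :
    Consistent ε (and γ φ) ∨ Consistent ε (and γ (neg φ)) := by
  by_contra hc
  rw [not_or] at hc
  have h₁ : Provable ε (imp (and γ φ) bot) := not_not.1 hc.1
  have h₂ : Provable ε (imp (and γ (neg φ)) bot) := not_not.1 hc.2
  refine h (Derives.entail₂ h₁ h₂ fun v => ?_)
  simp only [eval_imp, eval, bot]
  tauto

/-- Contrapositive of (R3) under the hypothesis `γ`: otherwise `γ` would derive every `L r φ`. -/
theorem Consistent.exists_bound (h : Consistent ε γ) (φ : Formula) :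
    ∃ r, Consistent ε (and γ (neg (L r φ))) := by
  by_contra! hc
  exact h (provable_imp_iff.2 (.R3 0 φ fun r _ => .of_inconsistent_and_neg (hc r)))

/-- Contrapositive of (R2): a refutation of `L s φ` can be witnessed by a refuted `L r φ` with
smaller index. -/
theorem Consistent.exists_lt {s : ℚ≥0} (h : Consistent ε (and γ (neg (L s φ)))) :
    ∃ r < s, Consistent ε (and (and γ (neg (L s φ))) (neg (L r φ))) := by
  by_contra! hc
  have hs : Derives ε {and γ (neg (L s φ))} (L s φ) :=
    .R2 s φ fun r hr => .of_inconsistent_and_neg (hc r hr)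
  refine h (provable_imp_iff.2 (Derives.entail₂ hs (.hyp rfl) (fun v => ?_)))
  simp only [eval, bot]
  tauto

/-- One step in the construction of a saturated set: `γ` is strengthened so that it decides `φ`,
with witnesses against the rules (R2) and (R3). -/
theorem Consistent.exists_step (h : Consistent ε γ) (φ : Formula) :
    ∃ γ', Consistent ε γ' ∧ Provable ε (imp γ' γ) ∧
      (Provable ε (imp γ' φ) ∨ Provable ε (imp γ' (neg φ)) ∧
        ∀ s ψ, φ = L s ψ → ∃ r < s, Provable ε (imp γ' (neg (L r ψ)))) ∧
      ∃ r, Provable ε (imp γ' (neg (L r φ))) := by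
  obtain ⟨b, hb⟩ := h.exists_bound φ
  have left : ∀ α β : Formula, Provable ε (imp (and α β) α) := fun α β =>
    provable_imp_of_entail fun v h => h.1
  have right : ∀ α β : Formula, Provable ε (imp (and α β) β) := fun α β =>
    provable_imp_of_entail fun v h => h.2
  rcases hb.and_or φ with h₁ | h₁
  · exact ⟨_, h₁, provable_imp_trans (left _ _) (left _ _), .inl (right _ _), b,
      provable_imp_trans (left _ _) (right _ _)⟩
  · by_cases hL : ∃ s ψ, φ = L s ψ
    · obtain ⟨s, ψ, rfl⟩ := hL
      obtain ⟨r, hr, h₂⟩ := h₁.exists_lt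
      refine ⟨_, h₂, provable_imp_trans (left _ _) (provable_imp_trans (left _ _) (left _ _)),
        .inr ⟨provable_imp_trans (left _ _) (right _ _), ?_⟩, b,
        provable_imp_trans (left _ _) (provable_imp_trans (left _ _) (right _ _))⟩
      rintro s' ψ' ⟨⟩
      exact ⟨r, hr, right _ _⟩
    · exact ⟨_, h₁, provable_imp_trans (left _ _) (left _ _),
        .inr ⟨right _ _, fun s ψ e => (hL ⟨s, ψ, e⟩).elim⟩, b,
        provable_imp_trans (left _ _) (right _ _)⟩

end Derivability

/-! ## Saturated sets -/

/-- An injective numbering of formulae, relative to a numbering `f` of the indices. -/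
def Formula.code (f : ℚ≥0 → ℕ) : Formula → ℕ
  | top => 0
  | neg φ => 3 * code f φ + 1
  | and φ ψ => 3 * Nat.pair (code f φ) (code f ψ) + 2
  | L r φ => 3 * Nat.pair (f r) (code f φ) + 3

/-- Residues mod 3 separate the constructors, except `top` and `L`, whose codes are `0` and at least
`3`. -/
theorem Formula.code_injective {f : ℚ≥0 → ℕ} (hf : f.Injective) : (code f).Injective := by
  intro φ
  induction φ with
  | top =>
    intro ψ h
    cases ψ <;> simp only [code] at h <;> first | rfl | omega
  | neg φ ih =>
    intro ψ h
    cases ψ <;> simp only [code] at h <;> try omega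
    exact congrArg neg (ih (by omega))
  | and φ₁ φ₂ ih₁ ih₂ =>
    intro ψ h
    cases ψ <;> simp only [code] at h <;> try omega
    obtain ⟨h₁, h₂⟩ := Nat.pair_eq_pair.1 (Nat.eq_of_mul_eq_mul_left (by norm_num : 0 < 3)
      (Nat.add_right_cancel h))
    rw [ih₁ h₁, ih₂ h₂]
  | L r φ ih =>
    intro ψ h
    cases ψ <;> simp only [code] at h <;> try omega
    obtain ⟨h₁, h₂⟩ := Nat.pair_eq_pair.1 (Nat.eq_of_mul_eq_mul_left (by norm_num : 0 < 3)
      (Nat.add_right_cancel h))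
    rw [hf h₁, ih h₂]

instance : Countable Formula :=
  let ⟨_, hf⟩ := exists_injective_nat ℚ≥0
  (code_injective hf).countable

/-- A complete set of formulae that contains the theorems and is closed under modus ponens and
under the rules (R2) and (R3). -/
structure Saturated (ε : ℚ≥0) (Γ : Set Formula) : Prop where
  theorem_mem : ∀ {φ}, Provable ε φ → φ ∈ Γ
  mp : ∀ {φ ψ}, imp φ ψ ∈ Γ → φ ∈ Γ → ψ ∈ Γ
  neg_mem_iff : ∀ {φ}, neg φ ∈ Γ ↔ φ ∉ Γ
  L_mem : ∀ {s φ}, (∀ r < s, L r φ ∈ Γ) → L s φ ∈ Γ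
  exists_notMem : ∀ φ, ∃ r, L r φ ∉ Γ

/-- A chain of ever stronger single formulae `c n` is built, stage `n + 1` deciding the `n`-th
formula; the saturated set consists of the consequences of the stages. Such a union need not be
closed under infinitary rules, so closure under (R2) and (R3) comes from the witnesses placed along
the chain. -/
theorem Consistent.exists_saturated {ε : ℚ≥0} {γ : Formula} (h : Consistent ε γ) :
    ∃ Γ, Saturated ε Γ ∧ γ ∈ Γ := by
  have : Nonempty Formula := ⟨top⟩
  obtain ⟨e, he⟩ := exists_surjective_nat Formula
  choose! g hcons himp hdec hbd using
    fun (γ : Formula) (h : Consistent ε γ) (φ : Formula) => h.exists_step φ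
  let c : ℕ → Formula := fun n => Nat.rec γ (fun n δ => g δ (e n)) n
  have hc : ∀ n, Consistent ε (c n) := by
    intro n
    induction n with
    | zero => exact h
    | succ n ih => exact hcons _ ih _
  have hanti : ∀ m n, m ≤ n → Provable ε (imp (c n) (c m)) := by
    intro m n hmn
    induction n, hmn using Nat.le_induction with
    | base => exact provable_imp_of_entail fun v h => h
    | succ n _ ih => exact provable_imp_trans (himp _ (hc n) _) ih
  have hup : ∀ {m n φ}, m ≤ n → Provable ε (imp (c m) φ) → Provable ε (imp (c n) φ) :=
    fun hmn h => provable_imp_trans (hanti _ _ hmn) h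
  have hnot : ∀ {φ m n}, Provable ε (imp (c m) φ) → ¬ Provable ε (imp (c n) (neg φ)) := by
    intro φ m n h₁ h₂
    refine hc (max m n) (Derives.entail₂ (hup (le_max_left m n) h₁)
      (hup (le_max_right m n) h₂) fun v => ?_)
    simp only [eval_imp, eval]
    tauto
  refine ⟨{φ | ∃ n, Provable ε (imp (c n) φ)}, ⟨?_, ?_, ?_, ?_, ?_⟩, 0, hanti 0 0 le_rfl⟩
  · intro φ hφ
    exact ⟨0, Derives.entail hφ fun v hv => (eval_imp _ _ _).2 fun _ => hv⟩
  · rintro φ ψ ⟨m, h₁⟩ ⟨n, h₂⟩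
    refine ⟨max m n, Derives.entail₂ (hup (le_max_left m n) h₁)
      (hup (le_max_right m n) h₂) fun v => ?_⟩
    simp only [eval_imp]
    tauto
  · intro φ
    constructor
    · rintro ⟨m, h₁⟩ ⟨n, h₂⟩
      exact hnot h₂ h₁
    · intro hφ
      obtain ⟨n, rfl⟩ := he φ
      rcases hdec _ (hc n) (e n) with h₁ | h₁
      · exact (hφ ⟨n + 1, h₁⟩).elim
      · exact ⟨n + 1, h₁.1⟩
  · intro s φ hs
    obtain ⟨n, hn⟩ := he (L s φ)
    rcases hdec _ (hc n) (e n) with h₁ | ⟨_, h₁⟩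
    · exact ⟨n + 1, hn ▸ h₁⟩
    -- The stage that refuted `L s φ` also refuted some `L r φ` with `r < s`, contrary to `hs`.
    · obtain ⟨r, hr, h₂⟩ := h₁ s φ hn
      obtain ⟨m, hm⟩ := hs r hr
      exact (hnot (n := n + 1) hm h₂).elim
  · intro φ
    obtain ⟨n, rfl⟩ := he φ
    obtain ⟨r, hr⟩ := hbd _ (hc n) (e n)
    exact ⟨r, fun ⟨m, hm⟩ => hnot (n := n + 1) hm hr⟩

namespace Saturated

variable {ε : ℚ≥0} {Γ : Set Formula} {φ ψ : Formula}

theorem mem_of_provable_imp (hΓ : Saturated ε Γ) (h : Provable ε (imp φ ψ)) (hφ : φ ∈ Γ) :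
    ψ ∈ Γ :=
  hΓ.mp (hΓ.theorem_mem h) hφ

theorem mem_of_entail (hΓ : Saturated ε Γ) (h : ∀ v, eval v φ → eval v ψ) (hφ : φ ∈ Γ) :
    ψ ∈ Γ :=
  hΓ.mem_of_provable_imp (provable_imp_of_entail h) hφ

theorem and_mem_iff (hΓ : Saturated ε Γ) : and φ ψ ∈ Γ ↔ φ ∈ Γ ∧ ψ ∈ Γ := by
  refine ⟨fun h => ⟨hΓ.mem_of_entail (φ := and φ ψ) (fun v h => h.1) h,
      hΓ.mem_of_entail (φ := and φ ψ) (fun v h => h.2) h⟩,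
    fun h => hΓ.mp (hΓ.mem_of_entail (ψ := imp ψ (and φ ψ)) (fun v hv => ?_) h.1) h.2⟩
  simp only [eval_imp, eval]
  tauto

theorem top_mem (hΓ : Saturated ε Γ) : top ∈ Γ :=
  hΓ.theorem_mem (.taut fun _ => trivial)

theorem consistent_of_mem (hΓ : Saturated ε Γ) (h : φ ∈ Γ) : Consistent ε φ := fun hc =>
  hΓ.neg_mem_iff.1 (hΓ.mem_of_provable_imp hc h) hΓ.top_mem

theorem L_mem_of_le (hΓ : Saturated ε Γ) {r s : ℚ≥0} (hrs : r ≤ s) (h : L s φ ∈ Γ) :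
    L r φ ∈ Γ := by
  obtain ⟨t, rfl⟩ := exists_add_of_le hrs
  exact hΓ.mem_of_provable_imp (.A2 r t φ) h

end Saturated

/-! ### Values of formulae in a saturated set. -/

theorem exists_nnrat_btwn {a b : ℝ} (ha : 0 ≤ a) (hab : a < b) :
    ∃ q : ℚ≥0, a < q ∧ (q : ℝ) < b := by
  obtain ⟨q, h₁, h₂⟩ := exists_rat_btwn hab
  exact ⟨⟨q, by exact_mod_cast ha.trans h₁.le⟩, h₁, h₂⟩

/-- The largest `r` such that `L r φ ∈ Γ`. -/
noncomputable def value (Γ : Set Formula) (φ : Formula) : ℝ :=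
  sSup {x : ℝ | ∃ r : ℚ≥0, L r φ ∈ Γ ∧ (r : ℝ) = x}

namespace Saturated

variable {ε : ℚ≥0} {Γ : Set Formula} {φ ψ : Formula}

theorem bddAbove (hΓ : Saturated ε Γ) (φ : Formula) :
    BddAbove {x : ℝ | ∃ r : ℚ≥0, L r φ ∈ Γ ∧ (r : ℝ) = x} := by
  obtain ⟨b, hb⟩ := hΓ.exists_notMem φ
  refine ⟨b, ?_⟩
  rintro _ ⟨r, hr, rfl⟩
  by_contra! hlt
  exact hb (hΓ.L_mem_of_le (by exact_mod_cast hlt.le) hr)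

theorem exists_lt_of_lt_value (hΓ : Saturated ε Γ) {x : ℝ} (h : x < value Γ φ) :
    ∃ r : ℚ≥0, L r φ ∈ Γ ∧ x < r := by
  have hne : {x : ℝ | ∃ r : ℚ≥0, L r φ ∈ Γ ∧ (r : ℝ) = x}.Nonempty :=
    ⟨ε, ε, hΓ.theorem_mem (.A1 φ), rfl⟩
  obtain ⟨_, ⟨r, hr, rfl⟩, hx⟩ := exists_lt_of_lt_csSup hne h
  exact ⟨r, hr, hx⟩

/-- Closure under (R2) says that the supremum is attained whenever it is rational. -/
theorem L_mem_iff (hΓ : Saturated ε Γ) {r : ℚ≥0} : L r φ ∈ Γ ↔ (r : ℝ) ≤ value Γ φ := by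
  refine ⟨fun h => le_csSup (hΓ.bddAbove φ) ⟨r, h, rfl⟩, fun h => hΓ.L_mem fun s hs => ?_⟩
  obtain ⟨t, ht, hst⟩ := hΓ.exists_lt_of_lt_value
    (lt_of_lt_of_le (by exact_mod_cast hs : (s : ℝ) < r) h)
  exact hΓ.L_mem_of_le (by exact_mod_cast hst.le) ht

theorem le_value (hΓ : Saturated ε Γ) (φ : Formula) : (ε : ℝ) ≤ value Γ φ :=
  hΓ.L_mem_iff.1 (hΓ.theorem_mem (.A1 φ))

theorem value_mono (hΓ : Saturated ε Γ) (h : Provable ε (imp φ ψ)) :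
    value Γ φ ≤ value Γ ψ := by
  by_contra! hlt
  obtain ⟨r, hr, hlt⟩ := hΓ.exists_lt_of_lt_value hlt
  exact hlt.not_ge (hΓ.L_mem_iff.1 (hΓ.mem_of_provable_imp (.R1 r h) hr))

theorem value_congr (hΓ : Saturated ε Γ) (h : ∀ v, eval v φ ↔ eval v ψ) :
    value Γ φ = value Γ ψ :=
  le_antisymm (hΓ.value_mono (provable_imp_of_entail fun v => (h v).1))
    (hΓ.value_mono (provable_imp_of_entail fun v => (h v).2))

/-- Additivity of `value Γ - ε`: (A4) gives `≤` and (A3) gives `≥`. -/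
theorem value_add (hΓ : Saturated ε Γ) (φ ψ : Formula) :
    value Γ φ + ε = value Γ (and φ ψ) + value Γ (and φ (neg ψ)) := by
  have h₁ := hΓ.le_value (and φ ψ)
  have h₂ := hΓ.le_value (and φ (neg ψ))
  have h₀ := hΓ.le_value φ
  have hε : (0 : ℝ) ≤ ε := by positivity
  apply le_antisymm
  · by_contra! hlt
    -- Rationals `x`, `y` strictly above the two values, with `x + y < value Γ φ + ε`: (A4) then
    -- refutes `L t φ` for `t = x + y - ε`, although `t < value Γ φ`.
    obtain ⟨x, hx₁, hx₂⟩ := exists_nnrat_btwn (hε.trans h₁)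
      (show value Γ (and φ ψ) < value Γ φ + ε - value Γ (and φ (neg ψ)) by linarith)
    obtain ⟨y, hy₁, hy₂⟩ := exists_nnrat_btwn (hε.trans h₂)
      (show value Γ (and φ (neg ψ)) < value Γ φ + ε - x by linarith)
    obtain ⟨t, ht⟩ := exists_add_of_le
      (show ε ≤ x + y by exact_mod_cast (show (ε : ℝ) ≤ x + y by linarith))
    have htR : (x : ℝ) + y = ε + t := by exact_mod_cast ht
    have hmem : neg (L t φ) ∈ Γ := by
      refine hΓ.mem_of_provable_imp (.A4 x y t φ ψ (by rw [ht, add_comm]))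
        (hΓ.and_mem_iff.2 ⟨hΓ.neg_mem_iff.2 ?_, hΓ.neg_mem_iff.2 ?_⟩)
      · rw [hΓ.L_mem_iff]
        exact hx₁.not_ge
      · rw [hΓ.L_mem_iff]
        exact hy₁.not_ge
    rw [hΓ.neg_mem_iff, hΓ.L_mem_iff] at hmem
    linarith
  -- Dually, `L x` and `L y` hold with `x + y > value Γ φ + ε`, and (A3) yields `L t φ` with `t >
  -- value Γ φ`.
  · by_contra! hlt
    obtain ⟨x, hx₁, hx₂⟩ := hΓ.exists_lt_of_lt_value
      (show value Γ φ + ε - value Γ (and φ (neg ψ)) < value Γ (and φ ψ) by linarith)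
    obtain ⟨y, hy₁, hy₂⟩ := hΓ.exists_lt_of_lt_value
      (show value Γ φ + ε - x < value Γ (and φ (neg ψ)) by linarith)
    obtain ⟨t, ht⟩ := exists_add_of_le
      (show ε ≤ x + y by exact_mod_cast (show (ε : ℝ) ≤ x + y by linarith))
    have htR : (x : ℝ) + y = ε + t := by exact_mod_cast ht
    have hmem : L t φ ∈ Γ := hΓ.mem_of_provable_imp (.A3 x y t φ ψ (by rw [ht, add_comm]))
      (hΓ.and_mem_iff.2 ⟨hx₁, hy₁⟩)
    rw [hΓ.L_mem_iff] at hmem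
    linarith

/-- Provably false formulae have the least possible value: the value `x` satisfies
`x + ε = x + x`. -/
theorem value_eq_of_not_consistent (hΓ : Saturated ε Γ) (h : ¬ Consistent ε φ) :
    value Γ φ = ε := by
  have h : Provable ε (imp φ bot) := not_not.1 h
  have hφ : ∀ ψ, value Γ (and φ ψ) = value Γ φ := fun ψ =>
    le_antisymm (hΓ.value_mono (provable_imp_of_entail fun v h => h.1))
      (hΓ.value_mono (Derives.entail h fun v => by simp only [eval_imp, eval, bot]; tauto))
  have := hΓ.value_add φ top
  rw [hφ, hφ] at this
  linarith

end Saturated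

/-! ## Cells -/

/-- The conjunctions of `φ` with `±ψ`, for all `ψ` in a list. -/
def cells : List Formula → Formula → List Formula
  | [], φ => [φ]
  | ψ :: l, φ => cells l (and φ ψ) ++ cells l (and φ (neg ψ))

theorem entail_of_mem_cells {l : List Formula} {φ c : Formula} (hc : c ∈ cells l φ)
    {v : ℚ≥0 → Formula → Prop} (h : eval v c) : eval v φ := by
  induction l generalizing φ with
  | nil => rwa [← List.mem_singleton.1 hc]
  | cons ψ l ih =>
    rcases List.mem_append.1 hc with hc | hc
    · exact (ih hc).1
    · exact (ih hc).1

theorem decide_of_mem_cells {l : List Formula} {φ c ψ : Formula} (hc : c ∈ cells l φ)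
    (hψ : ψ ∈ l) : (∀ v, eval v c → eval v ψ) ∨ (∀ v, eval v c → ¬ eval v ψ) := by
  induction l generalizing φ with
  | nil => simp at hψ
  | cons χ l ih =>
    rcases List.mem_cons.1 hψ with rfl | hψ
    · rcases List.mem_append.1 hc with hc | hc
      · exact .inl fun v h => (entail_of_mem_cells hc h).2
      · exact .inr fun v h => (entail_of_mem_cells hc h).2
    · rcases List.mem_append.1 hc with hc | hc
      · exact ih hc hψ
      · exact ih hc hψ

namespace Saturated

variable {ε : ℚ≥0} {Γ : Set Formula} {φ : Formula}

theorem exists_cell_mem (hΓ : Saturated ε Γ) (l : List Formula) (h : φ ∈ Γ) :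
    ∃ c ∈ cells l φ, c ∈ Γ := by
  induction l generalizing φ with
  | nil => exact ⟨φ, List.mem_singleton.2 rfl, h⟩
  | cons ψ l ih =>
    by_cases hψ : ψ ∈ Γ
    · obtain ⟨c, hc, hcΓ⟩ := ih (hΓ.and_mem_iff.2 ⟨h, hψ⟩)
      exact ⟨c, List.mem_append_left _ hc, hcΓ⟩
    · obtain ⟨c, hc, hcΓ⟩ := ih (hΓ.and_mem_iff.2 ⟨h, hΓ.neg_mem_iff.2 hψ⟩)
      exact ⟨c, List.mem_append_right _ hc, hcΓ⟩

/-- `value_add` iterated along the list. The extra conjunct `ψ` lets the sum be compared term by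
term with the mass of the cells entailing `ψ`. -/
theorem sum_cells (hΓ : Saturated ε Γ) (l : List Formula) (φ ψ : Formula) :
    ((cells l φ).map fun c => value Γ (and c ψ) - ε).sum = value Γ (and φ ψ) - ε := by
  induction l generalizing φ with
  | nil => simp [cells]
  | cons χ l ih =>
    have h := hΓ.value_add (and φ ψ) χ
    rw [hΓ.value_congr (φ := and (and φ ψ) χ) (ψ := and (and φ χ) ψ)
        (fun v => by simp only [eval]; tauto),
      hΓ.value_congr (φ := and (and φ ψ) (neg χ)) (ψ := and (and φ (neg χ)) ψ)
        (fun v => by simp only [eval]; tauto)] at h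
    rw [cells, List.map_append, List.sum_append, ih, ih]
    linarith

end Saturated

/-! ## The finite model -/

/-- The consistent cells over `l`. -/
abbrev CellState (ε : ℚ≥0) (l : List Formula) : Type :=
  {c : Formula // c ∈ cells l top ∧ Consistent ε c}

instance (ε : ℚ≥0) (l : List Formula) : Finite (CellState ε l) :=
  ((List.finite_toSet (cells l top)).subset fun _ h => h.1 :
    {c : Formula | c ∈ cells l top ∧ Consistent ε c}.Finite)

theorem isAnalyticSpace_of_finite (M : Type) [TopologicalSpace M] [DiscreteTopology M]
    [Finite M] : IsAnalyticSpace M :=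
  ⟨M, M, inferInstance, inferInstance, inferInstance, inferInstance, id, continuous_id,
    ⟨(Homeomorph.Set.univ M).symm.trans (Homeomorph.setCongr Set.range_id.symm)⟩⟩

open Classical in
/-- The measure on cells given by the values of a saturated set. -/
noncomputable def cellMeasure (ε : ℚ≥0) (l : List Formula) (Γ : Set Formula) :
    @Measure (CellState ε l) ⊤ :=
  letI : MeasurableSpace (CellState ε l) := ⊤
  -- Summing over positions in the list makes it unnecessary to know that the cells are distinct.
  -- Omitting the inconsistent ones loses no mass, since their value is `ε`.
  ∑ i : Fin (cells l top).length,
    if h : Consistent ε (cells l top)[i] then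
      ENNReal.ofReal (value Γ (cells l top)[i] - ε) •
        Measure.dirac (⟨(cells l top)[i], List.getElem_mem _, h⟩ : CellState ε l)
    else 0

/-- Compare with `sum_cells` cell by cell: if `c` entails `ψ`, then `and c ψ` has the value of `c`;
if `c` refutes `ψ` or is inconsistent, then `and c ψ` is inconsistent and has value `ε`. -/
theorem cellMeasure_apply {ε : ℚ≥0} {l : List Formula} {Γ : Set Formula} (hΓ : Saturated ε Γ)
    {ψ : Formula} (hψ : ψ ∈ l) (S : Set (CellState ε l))
    (hS : ∀ c, c ∈ S ↔ ∀ v, eval v c.1 → eval v ψ) :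
    cellMeasure ε l Γ S = ENNReal.ofReal (value Γ ψ - ε) := by
  classical
  let _ : MeasurableSpace (CellState ε l) := ⊤
  have hsum := hΓ.sum_cells l top ψ
  rw [hΓ.value_congr (φ := and top ψ) (ψ := ψ) (fun v => by simp [eval]),
    ← Fin.sum_univ_fun_getElem] at hsum
  rw [cellMeasure, Measure.finsetSum_apply, ← hsum,
    ENNReal.ofReal_sum_of_nonneg fun i _ => sub_nonneg.2 (hΓ.le_value _)]
  refine Finset.sum_congr rfl fun i _ => ?_
  change _ = ENNReal.ofReal (value Γ (and (cells l top)[i] ψ) - ε)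
  have hi : (cells l top)[i] ∈ cells l top := List.getElem_mem _
  split_ifs with hc
  · rw [Measure.smul_apply, Measure.dirac_apply, smul_eq_mul]
    rcases decide_of_mem_cells hi hψ with hd | hd
    · rw [Set.indicator_of_mem ((hS _).2 hd), Pi.one_apply, mul_one,
        hΓ.value_congr (φ := and (cells l top)[i] ψ) (ψ := (cells l top)[i])
          fun v => ⟨fun h => h.1, fun h => ⟨h, hd v h⟩⟩]
    · rw [Set.indicator_of_notMem, mul_zero, hΓ.value_eq_of_not_consistent, sub_self,
        ENNReal.ofReal_zero]
      · exact not_not.2 (provable_imp_of_entail fun v h => (hd v h.1 h.2).elim)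
      · intro hmem
        refine hc (provable_imp_of_entail fun v h => (hd v h ((hS _).1 hmem v h)).elim)
  · rw [hΓ.value_eq_of_not_consistent, sub_self, ENNReal.ofReal_zero]
    · rfl
    · refine not_not.2 (provable_imp_trans (provable_imp_of_entail fun v h => h.1)
        (not_not.1 hc))

theorem isFiniteMeasure_cellMeasure (ε : ℚ≥0) (l : List Formula) (Γ : Set Formula) :
    @IsFiniteMeasure (CellState ε l) ⊤ (cellMeasure ε l Γ) := by
  let _ : MeasurableSpace (CellState ε l) := ⊤
  refine ⟨?_⟩
  rw [cellMeasure, Measure.finsetSum_apply, ENNReal.sum_lt_top]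
  intro i _
  split_ifs <;> simp

/-- A saturated set that contains a given consistent cell. -/
noncomputable def CellState.theory {ε : ℚ≥0} {l : List Formula} (c : CellState ε l) :
    Set Formula :=
  c.2.2.exists_saturated.choose

theorem CellState.saturated_theory {ε : ℚ≥0} {l : List Formula} (c : CellState ε l) :
    Saturated ε c.theory :=
  c.2.2.exists_saturated.choose_spec.1

theorem CellState.mem_theory {ε : ℚ≥0} {l : List Formula} (c : CellState ε l) :
    c.1 ∈ c.theory :=
  c.2.2.exists_saturated.choose_spec.2

/-- On formulae of `l` the arbitrary choice of saturated extension is immaterial, because the cell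
already decides them. -/
theorem CellState.mem_theory_iff {ε : ℚ≥0} {l : List Formula} (c : CellState ε l) {ψ : Formula}
    (hψ : ψ ∈ l) : ψ ∈ c.theory ↔ ∀ v, eval v c.1 → eval v ψ := by
  refine ⟨fun h => (decide_of_mem_cells c.2.1 hψ).resolve_right fun hd => ?_,
    fun h => c.saturated_theory.mem_of_entail h c.mem_theory⟩
  exact c.saturated_theory.neg_mem_iff.1
    (c.saturated_theory.mem_of_entail (ψ := neg ψ) hd c.mem_theory) h

/-- The continuous Markov kernel on the consistent cells over `l`. -/
noncomputable def cellModel (ε : ℚ≥0) (l : List Formula) : CMK.{0} :=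
  letI : TopologicalSpace (CellState ε l) := ⊥
  haveI : DiscreteTopology (CellState ε l) := ⟨rfl⟩
  letI : MeasurableSpace (CellState ε l) := ⊤
  { carrier := CellState ε l
    borel := ⟨borel_eq_top_of_discrete.symm⟩
    analytic := isAnalyticSpace_of_finite _
    θ := ⟨fun c => cellMeasure ε l c.theory, measurable_from_top⟩
    finite_rate := fun c => isFiniteMeasure_cellMeasure ε l c.theory }

/-- The subformulae of a formula. -/
def Formula.subformulas : Formula → List Formula
  | top => [top]
  | neg φ => neg φ :: subformulas φ
  | and φ ψ => and φ ψ :: (subformulas φ ++ subformulas ψ)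
  | L r φ => L r φ :: subformulas φ

theorem Formula.self_mem_subformulas (φ : Formula) : φ ∈ subformulas φ := by
  cases φ <;> simp [subformulas]

/-- Truth lemma. In the case of `L r φ`, the induction hypothesis identifies the states satisfying
`φ` with the cells entailing it, whose mass is known. -/
theorem cellModel_sat_iff (ε : ℚ≥0) {l : List Formula} {φ : Formula} (hφ : subformulas φ ⊆ l)
    (c : CellState ε l) : (cellModel ε l).Sat ε φ c ↔ φ ∈ c.theory := by
  induction φ generalizing c with
  | top => exact ⟨fun _ => c.saturated_theory.top_mem, fun _ => trivial⟩
  | neg φ ih =>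
    rw [c.saturated_theory.neg_mem_iff, ← ih (List.subset_of_cons_subset hφ) c]
    rfl
  | and φ ψ ih₁ ih₂ =>
    have h := List.append_subset.1 (List.subset_of_cons_subset hφ)
    rw [c.saturated_theory.and_mem_iff, ← ih₁ h.1 c, ← ih₂ h.2 c]
    rfl
  | L r φ ih =>
    have h : subformulas φ ⊆ l := List.subset_of_cons_subset hφ
    have hmem : φ ∈ l := h φ.self_mem_subformulas
    have hval : cellMeasure ε l c.theory {n | (cellModel ε l).Sat ε φ n} =
        ENNReal.ofReal (value c.theory φ - ε) :=
      cellMeasure_apply c.saturated_theory hmem _ fun n =>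
        (ih h n).trans (n.mem_theory_iff hmem)
    have hle := c.saturated_theory.le_value φ
    have hreal : (((cellModel ε l).θ c).real {n | (cellModel ε l).Sat ε φ n}) =
        value c.theory φ - ε :=
      (congrArg ENNReal.toReal hval).trans (ENNReal.toReal_ofReal (sub_nonneg.2 hle))
    rw [c.saturated_theory.L_mem_iff]
    change (r : ℝ) ≤ ((cellModel ε l).θ c).real {n | (cellModel ε l).Sat ε φ n} + (ε : ℝ) ↔ _
    rw [hreal, sub_add_cancel]

end CML

theorem mainTheorem8 (ε : ℚ≥0) (φ : CML.Formula) (hφ : CML.Consistent ε φ) :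
    ∃ M : CML.CMK.{0}, Finite M.carrier ∧ ∃ m : M.carrier, M.Sat ε φ m := by
  obtain ⟨Γ, hΓ, hmem⟩ := hφ.exists_saturated
  obtain ⟨c, hc, hcΓ⟩ := hΓ.exists_cell_mem φ.subformulas hΓ.top_mem
  let m : CML.CellState ε φ.subformulas := ⟨c, hc, hΓ.consistent_of_mem hcΓ⟩
  refine ⟨CML.cellModel ε φ.subformulas,
    inferInstanceAs (Finite (CML.CellState ε φ.subformulas)), m,
    (CML.cellModel_sat_iff ε (List.Subset.refl _) m).2 ?_⟩
  -- `m.theory` may differ from `Γ`, so `φ` is carried over through the cell: `c` decides `φ`, and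
  -- it cannot refute it since both lie in `Γ`.
  refine (m.mem_theory_iff φ.self_mem_subformulas).2
    ((CML.decide_of_mem_cells hc φ.self_mem_subformulas).resolve_right fun hd => ?_)
  exact hΓ.neg_mem_iff.1 (hΓ.mem_of_entail (ψ := .neg φ) hd hcΓ) hmem
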